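/- Theorem. Let $V$ be a finite set of state variables ranging over $\mathbb Z$. A trace is a nonempty finite sequence $\tau=\alpha_0,\dots,\alpha_{n-1}$ of assignments $\alpha_i\colon V\to\mathbb Z$. A variable with lookahead $j\ge 0$ is a $v\in V$ decorated with $j$ primes; at instant $i$ of $\tau$ it denotes $\alpha_{i+j}(v)$. An integer periodicity constraint (IPC) is a constraint of one of the forms $$x=y,\qquad x\odot d\ \ (\odot\in\{=,\neq,<,>\}),\qquad x\equiv_k y+d,\qquad x\equiv_k d,$$ where $x,y$ are variables with lookahead, $d,k\in\mathbb N$, $k\ge 1$, and $\equiv_k$ is congruence modulo $k$. IPC properties are given by the grammar $\psi ::= c\mid\psi\wedge\psi\mid\neg\psi\mid\mathsf X_s\psi\mid\psi\,\mathsf U\,\psi$ with $c$ an IPC. Satisfaction $\tau,i\models\psi$ is defined as follows: $\tau,i\models c$ iff $0\le i<n$ and either $c$ contains a variable whose lookahead $j$ satisfies $i+j\ge n$, or $c$ is true of the values its variables denote at instant $i$; $\wedge$ and $\neg$ are interpreted as usual; $\tau,i\models\mathsf X_s\psi$ iff $i<n-1$ and $\tau,i+1\models\psi$; and $\tau,i\models\psi_1\mathsf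 U\psi_2$ iff there is $j$ with $i\le j<n$, $\tau,j\models\psi_2$, and $\tau,k\models\psi_1$ for all $i\le k<j$. Write $\tau\models\psi$ for $\tau,0\models\psi$. The monitoring state of $\psi$ after $\tau$ is - $\mathrm{CS}$ (current satisfaction) if $\tau\models\psi$ and $\tau\tau'\not\models\psi$ for some trace $\tau'$; - $\mathrm{PS}$ (permanent satisfaction) if $\tau\models\psi$ and $\tau\tau'\models\psi$ for every trace $\tau'$; - $\mathrm{CV}$ (current violation) if $\tau\not\models\psi$ and $\tau\tau'\models\psi$ for some trace $\tau'$; - $\mathrm{PV}$ (permanent violation) if $\tau\not\models\psi$ and $\tau\tau'\not\models\psi$ for every trace $\tau'$. Then monitoring is solvable for IPC properties: there is an algorithm (a computable function) that, given any IPC property $\psi$ over $V$ and any trace $\tau$ over $V$, returns the monitoring state of $\psi$ after $\tau$. -/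

import Mathlib

/-- Linear integer expressions over the variables with lookahead: `var v j` is the state variable
`v` decorated with `j` primes, that is, the value of `v` looking `j` instants ahead. -/
inductive LExpr (n : ℕ) : Type
  | var : Fin n → ℕ → LExpr n
  | const : ℤ → LExpr n
  | add : LExpr n → LExpr n → LExpr n
  | smul : ℤ → LExpr n → LExpr n

/-- Arithmetic constraints; `cong k` and `ncong k` are (in)congruence modulo `k`. -/
inductive LConstraint (n : ℕ) : Type
  | eq : LExpr n → LExpr n → LConstraint n
  | ne : LExpr n → LExpr n → LConstraint n
  | lt : LExpr n → LExpr n → LConstraint n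
  | le : LExpr n → LExpr n → LConstraint n
  | cong : ℕ → LExpr n → LExpr n → LConstraint n
  | ncong : ℕ → LExpr n → LExpr n → LConstraint n

/-- Properties: linear-time temporal formulas (finite traces) with constraints as atoms. -/
inductive LProp (n : ℕ) : Type
  | atom : LConstraint n → LProp n
  | and : LProp n → LProp n → LProp n
  | not : LProp n → LProp n
  | next : LProp n → LProp n
  | untl : LProp n → LProp n → LProp n

/-- An assignment of integers to the `n` state variables. -/
abbrev Assignment (n : ℕ) : Type := Fin n → ℤ

namespace LExpr

/-- The largest lookahead of a variable in the expression (`0` if there is none). -/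
def lookahead {n : ℕ} : LExpr n → ℕ
  | var _ j => j
  | const _ => 0
  | add e₁ e₂ => max e₁.lookahead e₂.lookahead
  | smul _ e => e.lookahead

/-- Evaluation at instant `i` of a finite sequence of assignments. The default value used by `getD`
is irrelevant for expressions that are well-defined at `i`. -/
def eval {n : ℕ} (τ : List (Assignment n)) (i : ℕ) : LExpr n → ℤ
  | var v j => τ.getD (i + j) 0 v
  | const k => k
  | add e₁ e₂ => e₁.eval τ i + e₂.eval τ i
  | smul k e => k * e.eval τ i

/-- Gödel number of an expression. -/
def code {n : ℕ} : LExpr n → ℕ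
  | var v j => Nat.pair 0 (Nat.pair v j)
  | const k => Nat.pair 1 (Encodable.encode k)
  | add e₁ e₂ => Nat.pair 2 (Nat.pair e₁.code e₂.code)
  | smul k e => Nat.pair 3 (Nat.pair (Encodable.encode k) e.code)

theorem code_injective {n : ℕ} : Function.Injective (code : LExpr n → ℕ) := by
  intro a
  induction a with
  | var v j =>
    intro b h
    cases b <;> simp_all [code, Nat.pair_eq_pair, Fin.ext_iff]
  | const k =>
    intro b h
    cases b <;> simp_all [code, Nat.pair_eq_pair]
  | add e₁ e₂ h₁ h₂ =>
    intro b h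
    cases b with
    | add f₁ f₂ =>
      simp only [code, Nat.pair_eq_pair, true_and] at h
      rw [h₁ h.1, h₂ h.2]
    | _ => simp [code, Nat.pair_eq_pair] at h
  | smul k e h₁ =>
    intro b h
    cases b with
    | smul l f =>
      simp only [code, Nat.pair_eq_pair, true_and, Encodable.encode_inj] at h
      rw [h.1, h₁ h.2]
    | _ => simp [code, Nat.pair_eq_pair] at h

end LExpr

namespace LConstraint

/-- The largest lookahead of a variable in the constraint (`0` if there is none). -/
def lookahead {n : ℕ} : LConstraint n → ℕ
  | eq e₁ e₂ | ne e₁ e₂ | lt e₁ e₂ | le e₁ e₂ | cong _ e₁ e₂ | ncong _ e₁ e₂ =>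
    max e₁.lookahead e₂.lookahead

/-- The constraint refers only to instants of the sequence when it is read at instant `i`. -/
def WellDefined {n : ℕ} (τ : List (Assignment n)) (i : ℕ) (c : LConstraint n) : Prop :=
  i + c.lookahead < τ.length

/-- The comparison between the evaluations of the two sides. -/
def Holds {n : ℕ} (τ : List (Assignment n)) (i : ℕ) : LConstraint n → Prop
  | eq e₁ e₂ => e₁.eval τ i = e₂.eval τ i
  | ne e₁ e₂ => e₁.eval τ i ≠ e₂.eval τ i
  | lt e₁ e₂ => e₁.eval τ i < e₂.eval τ i
  | le e₁ e₂ => e₁.eval τ i ≤ e₂.eval τ i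
  | cong k e₁ e₂ => e₁.eval τ i ≡ e₂.eval τ i [ZMOD k]
  | ncong k e₁ e₂ => ¬ e₁.eval τ i ≡ e₂.eval τ i [ZMOD k]

/-- Gödel number of a constraint. -/
def code {n : ℕ} : LConstraint n → ℕ
  | eq e₁ e₂ => Nat.pair 0 (Nat.pair e₁.code e₂.code)
  | ne e₁ e₂ => Nat.pair 1 (Nat.pair e₁.code e₂.code)
  | lt e₁ e₂ => Nat.pair 2 (Nat.pair e₁.code e₂.code)
  | le e₁ e₂ => Nat.pair 3 (Nat.pair e₁.code e₂.code)
  | cong k e₁ e₂ => Nat.pair 4 (Nat.pair k (Nat.pair e₁.code e₂.code))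
  | ncong k e₁ e₂ => Nat.pair 5 (Nat.pair k (Nat.pair e₁.code e₂.code))

theorem code_injective {n : ℕ} : Function.Injective (code : LConstraint n → ℕ) := by
  intro a b h
  cases a <;> cases b <;>
    simp_all [code, Nat.pair_eq_pair, LExpr.code_injective.eq_iff]

/-- Integer periodicity constraints `x = y`, `x = d`, `x ≠ d`, `x < d`, `x > d`, `x ≡ y + d (mod k)`
and `x ≡ d (mod k)`, where `x` and `y` are variables with lookahead, `d` is a natural number and
`k` is a positive natural number. -/
inductive IsIPC {n : ℕ} : LConstraint n → Prop
  | var_eq_var (x : Fin n) (i : ℕ) (y : Fin n) (j : ℕ) : IsIPC (eq (.var x i) (.var y j))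
  | var_eq (x : Fin n) (i d : ℕ) : IsIPC (eq (.var x i) (.const d))
  | var_ne (x : Fin n) (i d : ℕ) : IsIPC (ne (.var x i) (.const d))
  | var_lt (x : Fin n) (i d : ℕ) : IsIPC (lt (.var x i) (.const d))
  | var_gt (x : Fin n) (i d : ℕ) : IsIPC (lt (.const d) (.var x i))
  | cong_var (k : ℕ) (hk : 0 < k) (x : Fin n) (i : ℕ) (y : Fin n) (j d : ℕ) :
      IsIPC (cong k (.var x i) (.add (.var y j) (.const d)))
  | cong_const (k : ℕ) (hk : 0 < k) (x : Fin n) (i d : ℕ) : IsIPC (cong k (.var x i) (.const d))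

end LConstraint

namespace LProp

/-- Satisfaction at an instant of a finite sequence of assignments. Constraints with lookahead have
a weak semantics: they hold at an instant of the sequence where they are not well-defined. -/
def SatAt {n : ℕ} (τ : List (Assignment n)) : ℕ → LProp n → Prop
  | i, atom c => i < τ.length ∧ (¬ c.WellDefined τ i ∨ c.Holds τ i)
  | i, and ψ₁ ψ₂ => ψ₁.SatAt τ i ∧ ψ₂.SatAt τ i
  | i, not ψ => ¬ ψ.SatAt τ i
  | i, next ψ => i + 1 < τ.length ∧ ψ.SatAt τ (i + 1)
  | i, untl ψ₁ ψ₂ =>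
    ∃ j, i ≤ j ∧ j < τ.length ∧ ψ₂.SatAt τ j ∧ ∀ k, i ≤ k → k < j → ψ₁.SatAt τ k

/-- The usual recursive unfolding of the until operator. -/
theorem satAt_untl_iff {n : ℕ} (τ : List (Assignment n)) (i : ℕ) (ψ₁ ψ₂ : LProp n) :
    (untl ψ₁ ψ₂).SatAt τ i ↔
      i < τ.length ∧ (ψ₂.SatAt τ i ∨
        (i + 1 < τ.length ∧ ψ₁.SatAt τ i ∧ (untl ψ₁ ψ₂).SatAt τ (i + 1))) := by
  simp only [SatAt]
  constructor
  · rintro ⟨j, hij, hj, h₂, h₁⟩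
    refine ⟨by omega, ?_⟩
    rcases hij.eq_or_lt with rfl | hlt
    · exact Or.inl h₂
    · exact Or.inr ⟨by omega, h₁ i le_rfl hlt, j, hlt, hj, h₂,
        fun k hk hkj => h₁ k (by omega) hkj⟩
  · rintro ⟨hi, h₂ | ⟨_, h₁, j, hij, hj, h₂, h⟩⟩
    · exact ⟨i, le_rfl, hi, h₂, fun k hk hki => by omega⟩
    · refine ⟨j, by omega, hj, h₂, fun k hk hkj => ?_⟩
      rcases hk.eq_or_lt with rfl | hlt
      · exact h₁
      · exact h k hlt hkj

/-- Satisfaction by a trace. -/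
def Sat {n : ℕ} (τ : List (Assignment n)) (ψ : LProp n) : Prop := ψ.SatAt τ 0

/-- Gödel number of a property. -/
def code {n : ℕ} : LProp n → ℕ
  | atom c => Nat.pair 0 c.code
  | and ψ₁ ψ₂ => Nat.pair 1 (Nat.pair ψ₁.code ψ₂.code)
  | not ψ => Nat.pair 2 ψ.code
  | next ψ => Nat.pair 3 ψ.code
  | untl ψ₁ ψ₂ => Nat.pair 4 (Nat.pair ψ₁.code ψ₂.code)

theorem code_injective {n : ℕ} : Function.Injective (code : LProp n → ℕ) := by
  intro a
  induction a with
  | atom c =>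
    intro b h
    cases b <;> simp_all [code, Nat.pair_eq_pair, LConstraint.code_injective.eq_iff]
  | and ψ₁ ψ₂ h₁ h₂ =>
    intro b h
    cases b with
    | and φ₁ φ₂ =>
      simp only [code, Nat.pair_eq_pair, true_and] at h
      rw [h₁ h.1, h₂ h.2]
    | _ => simp [code, Nat.pair_eq_pair] at h
  | not ψ h₁ =>
    intro b h
    cases b with
    | not φ =>
      simp only [code, Nat.pair_eq_pair, true_and] at h
      rw [h₁ h]
    | _ => simp [code, Nat.pair_eq_pair] at h
  | next ψ h₁ =>
    intro b h
    cases b with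
    | next φ =>
      simp only [code, Nat.pair_eq_pair, true_and] at h
      rw [h₁ h]
    | _ => simp [code, Nat.pair_eq_pair] at h
  | untl ψ₁ ψ₂ h₁ h₂ =>
    intro b h
    cases b with
    | untl φ₁ φ₂ =>
      simp only [code, Nat.pair_eq_pair, true_and] at h
      rw [h₁ h.1, h₂ h.2]
    | _ => simp [code, Nat.pair_eq_pair] at h

/-- All atoms of the property are integer periodicity constraints. -/
def IsIPC {n : ℕ} : LProp n → Prop
  | atom c => c.IsIPC
  | and ψ₁ ψ₂ => ψ₁.IsIPC ∧ ψ₂.IsIPC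
  | not ψ => ψ.IsIPC
  | next ψ => ψ.IsIPC
  | untl ψ₁ ψ₂ => ψ₁.IsIPC ∧ ψ₂.IsIPC

end LProp

/-- The monitoring states: permanent satisfaction, current satisfaction, current violation,
permanent violation. -/
inductive MonState : Type
  | ps
  | cs
  | cv
  | pv

namespace MonState

/-- A numbering of the four monitoring states. -/
def equivFin : MonState ≃ Fin 4 where
  toFun
    | ps => 0
    | cs => 1
    | cv => 2
    | pv => 3
  invFun
    | 0 => ps
    | 1 => cs
    | 2 => cv
    | 3 => pv
  left_inv s := by cases s <;> rfl
  right_inv i := by fin_cases i <;> rfl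

instance instPrimcodable : Primcodable MonState := Primcodable.ofEquiv (Fin 4) equivFin

end MonState

/-- The property `ψ` is in the monitoring state `s` after the trace `τ`. Traces are nonempty finite
sequences of assignments, hence so are the continuations `τ'`. -/
def InMonState {n : ℕ} (ψ : LProp n) (τ : List (Assignment n)) : MonState → Prop
  | .cs => ψ.Sat τ ∧ ∃ τ' : List (Assignment n), τ' ≠ [] ∧ ¬ ψ.Sat (τ ++ τ')
  | .ps => ψ.Sat τ ∧ ∀ τ' : List (Assignment n), τ' ≠ [] → ψ.Sat (τ ++ τ')
  | .cv => ¬ ψ.Sat τ ∧ ∃ τ' : List (Assignment n), τ' ≠ [] ∧ ψ.Sat (τ ++ τ')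
  | .pv => ¬ ψ.Sat τ ∧ ∀ τ' : List (Assignment n), τ' ≠ [] → ¬ ψ.Sat (τ ++ τ')

/-- Monitoring is solvable for a class of properties: there is an algorithm which, given (the Gödel
number of) a property in the class and a trace, computes the monitoring state of the property after
the trace. The algorithm is uniform in the property; nothing is required of its outputs on other
inputs. -/
def MonitoringSolvable {n : ℕ} (P : Set (LProp n)) : Prop :=
  ∃ monitor : ℕ → List (Assignment n) → MonState,
    Computable₂ monitor ∧
      ∀ ψ ∈ P, ∀ τ : List (Assignment n), τ ≠ [] → InMonState ψ τ (monitor ψ.code τ)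

/-! Deciding whether a given finite sequence satisfies a property is plain evaluation; the
difficulty is the quantifier over all continuations, of unbounded length and with unbounded values.
It becomes a finite search once a computable function of `ψ.code` and the code of `τ` bounds the
code of some satisfying continuation, whenever one exists (`exists_small_continuation`). Permanent
satisfaction is then decided by searching for a continuation satisfying the negation.

The bound rests on a symmetry. IPCs compare two variables only by equality and congruence, never by
order. Hence a permutation of the integers that preserves residues modulo a common multiple of the
moduli, and the position relative to all small constants, leaves satisfaction unchanged
(`LProp.satAt_renameValues`). Such tame permutations can make finitely many values small
(`IsTame.exists_compress`).

For length: all lookaheads are at most `c`, so what a prefix can learn from a suffix is its first `c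
+ 1` assignments and which properties of code at most `c` it satisfies (`SuffixEquiv`). Up to tame
renaming there are boundedly many such data. A long continuation therefore has two suffixes that
match after renaming, and the piece between them can be cut out (`exists_short_continuation`). For
values: the whole sequence is compressed by a permutation fixing every value of `τ`.

A single number, the Gödel code, bounds lookaheads, constants, moduli and codes of subproperties at
once. Evaluation is shown primitive recursive through a table of truth values indexed by codes. -/

/-! ### Bounds on codes of lists, integers and traces -/

/-- A bound for the code of a list of length at most `m` whose entries have codes at most `B`. -/
def listCodeBound (B : ℕ) : ℕ → ℕ
  | 0 => 0
  | m + 1 => Nat.succ (Nat.pair B (listCodeBound B m))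

theorem Nat.pair_le_pair_of_le {a b c d : ℕ} (h₁ : a ≤ c) (h₂ : b ≤ d) :
    Nat.pair a b ≤ Nat.pair c d :=
  (StrictMono.monotone (fun _ _ h => Nat.pair_lt_pair_left b h) h₁).trans
    (StrictMono.monotone (fun _ _ h => Nat.pair_lt_pair_right c h) h₂)

theorem encode_list_le_listCodeBound {α : Type*} [Encodable α] {B : ℕ} :
    ∀ {l : List α} {m : ℕ}, (∀ a ∈ l, Encodable.encode a ≤ B) → l.length ≤ m →
      Encodable.encode l ≤ listCodeBound B m
  | [], _, _, _ => by simp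
  | a :: l, 0, _, h => by simp at h
  | a :: l, m + 1, hB, h => by
    rw [Encodable.encode_list_cons, listCodeBound]
    exact Nat.succ_le_succ (Nat.pair_le_pair_of_le (hB a (by simp))
      (encode_list_le_listCodeBound (fun b hb => hB b (by simp [hb])) (by simpa using h)))

theorem encode_le_encode_list {α : Type*} [Encodable α] {a : α} :
    ∀ {l : List α}, a ∈ l → Encodable.encode a ≤ Encodable.encode l
  | b :: l, h => by
    rw [Encodable.encode_list_cons]
    rcases List.mem_cons.1 h with rfl | h
    · exact (Nat.left_le_pair _ _).trans (Nat.le_succ _)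
    · exact (encode_le_encode_list h).trans ((Nat.right_le_pair _ _).trans (Nat.le_succ _))

theorem encode_intCast (d : ℕ) : Encodable.encode (d : ℤ) = 2 * d := rfl

theorem encode_negSucc (d : ℕ) : Encodable.encode (Int.negSucc d) = 2 * d + 1 := rfl

theorem Int.natAbs_le_encode (z : ℤ) : z.natAbs ≤ Encodable.encode z := by
  obtain ⟨d, rfl⟩ | ⟨d, rfl⟩ : (∃ d : ℕ, z = d) ∨ ∃ d : ℕ, z = Int.negSucc d := by
    cases z with
    | ofNat d => exact Or.inl ⟨d, rfl⟩
    | negSucc d => exact Or.inr ⟨d, rfl⟩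
  · rw [encode_intCast, Int.natAbs_natCast]; omega
  · rw [encode_negSucc, Int.natAbs_negSucc]; omega

theorem Int.encode_le_two_mul_natAbs (z : ℤ) : Encodable.encode z ≤ 2 * z.natAbs := by
  obtain ⟨d, rfl⟩ | ⟨d, rfl⟩ : (∃ d : ℕ, z = d) ∨ ∃ d : ℕ, z = Int.negSucc d := by
    cases z with
    | ofNat d => exact Or.inl ⟨d, rfl⟩
    | negSucc d => exact Or.inr ⟨d, rfl⟩
  · rw [encode_intCast, Int.natAbs_natCast]
  · rw [encode_negSucc, Int.natAbs_negSucc]; omega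

/-- Makes the code of an assignment that of the vector of its values, so that bounds on values give
bounds on codes and conversely. -/
instance (priority := high) Assignment.instEncodable (n : ℕ) : Encodable (Assignment n) :=
  Encodable.finArrow

theorem encode_assignment {n : ℕ} (a : Assignment n) :
    Encodable.encode a = Encodable.encode (List.ofFn a) := by
  rw [← List.Vector.toList_ofFn]
  have : (Equiv.vectorEquivFin ℤ n).symm a = List.Vector.ofFn a := by
    rw [Equiv.symm_apply_eq]
    funext i
    simp [Equiv.vectorEquivFin]
  rw [← this]
  rfl

theorem encode_list_length_le {α : Type*} [Encodable α] :
    ∀ l : List α, l.length ≤ Encodable.encode l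
  | [] => by simp
  | a :: l => by
    rw [Encodable.encode_list_cons, List.length_cons]
    exact Nat.succ_le_succ ((encode_list_length_le l).trans (Nat.right_le_pair _ _))

/-- All values in the sequence of assignments have absolute value at most `B`. -/
def ValuesBounded {n : ℕ} (B : ℕ) (σ : List (Assignment n)) : Prop :=
  ∀ a ∈ σ, ∀ v, (a v).natAbs ≤ B

/-- A bound for the code of a sequence of at most `m` assignments with values bounded by `B`. -/
def traceCodeBound (n B m : ℕ) : ℕ := listCodeBound (listCodeBound (2 * B) n) m

theorem encode_le_traceCodeBound {n B m : ℕ} {σ : List (Assignment n)} (hB : ValuesBounded B σ)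
    (hm : σ.length ≤ m) : Encodable.encode σ ≤ traceCodeBound n B m := by
  refine encode_list_le_listCodeBound (fun a ha => ?_) hm
  rw [encode_assignment]
  refine encode_list_le_listCodeBound (fun z hz => ?_) (by simp)
  obtain ⟨v, rfl⟩ := (List.mem_ofFn' _ _).1 hz
  exact (Int.encode_le_two_mul_natAbs _).trans (Nat.mul_le_mul_left 2 (hB a ha v))

theorem valuesBounded_encode {n : ℕ} (σ : List (Assignment n)) :
    ValuesBounded (Encodable.encode σ) σ := by
  intro a ha v
  refine (Int.natAbs_le_encode _).trans (le_trans ?_ (encode_le_encode_list ha))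
  rw [encode_assignment]
  exact encode_le_encode_list ((List.mem_ofFn' _ _).2 ⟨v, rfl⟩)

/-! ### Indistinguishable integers and tame permutations -/

/-- Two integers are indistinguishable if they are congruent modulo `K` and compare in the same way
with every integer of absolute value at most `M`. -/
def Indist (M K : ℕ) (z w : ℤ) : Prop :=
  z ≡ w [ZMOD K] ∧ ∀ d : ℤ, d.natAbs ≤ M → (z < d ↔ w < d) ∧ (d < z ↔ d < w)

namespace Indist

variable {M K : ℕ} {x y z w : ℤ}

theorem refl (z : ℤ) : Indist M K z z := ⟨rfl, fun _ _ => ⟨Iff.rfl, Iff.rfl⟩⟩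

theorem symm (h : Indist M K z w) : Indist M K w z :=
  ⟨h.1.symm, fun d hd => ⟨(h.2 d hd).1.symm, (h.2 d hd).2.symm⟩⟩

theorem trans (h : Indist M K x y) (h' : Indist M K y z) : Indist M K x z :=
  ⟨h.1.trans h'.1, fun d hd =>
    ⟨(h.2 d hd).1.trans (h'.2 d hd).1, (h.2 d hd).2.trans (h'.2 d hd).2⟩⟩

theorem lt_iff (h : Indist M K z w) {d : ℤ} (hd : d.natAbs ≤ M) : z < d ↔ w < d := (h.2 d hd).1

theorem gt_iff (h : Indist M K z w) {d : ℤ} (hd : d.natAbs ≤ M) : d < z ↔ d < w := (h.2 d hd).2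

theorem eq_iff (h : Indist M K z w) {d : ℤ} (hd : d.natAbs ≤ M) : z = d ↔ w = d := by
  have := h.lt_iff hd
  have := h.gt_iff hd
  omega

theorem eq_of_natAbs_le (h : Indist M K z w) (hz : z.natAbs ≤ M) : w = z :=
  (h.eq_iff hz).1 rfl

theorem neg (h : Indist M K z w) : Indist M K (-z) (-w) := by
  refine ⟨h.1.neg, fun d hd => ?_⟩
  have := h.2 (-d) (by simpa using hd)
  omega

/-- Among indistinguishable integers there are small ones outside any given finite set. -/
theorem exists_small_of_pos (hK : 0 < K) (U : Finset ℤ) (hz : (M : ℤ) < z) :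
    ∃ w ∉ U, Indist M K z w ∧ w.natAbs ≤ M + K * (U.card + 1) := by
  set g : ℕ → ℤ := fun j => M + 1 + (z - M - 1) % K + K * j with hg
  have hK' : (0 : ℤ) < K := by exact_mod_cast hK
  -- The progression `g` starts at the least integer above `M` congruent to `z` and has step `K`.
  -- All its terms are indistinguishable from `z`, and among the first `U.card + 1` of them one
  -- avoids `U`.
  have hinj : Function.Injective g := by
    intro i j h
    have : (K : ℤ) * i = K * j := by simpa [hg] using h
    exact_mod_cast mul_left_cancel₀ hK'.ne' this
  obtain ⟨w, hw, hwU⟩ := Finset.exists_mem_notMem_of_card_lt_card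
    (s := U) (t := (Finset.range (U.card + 1)).image g)
    (by rw [Finset.card_image_of_injective _ hinj, Finset.card_range]; omega)
  obtain ⟨j, hj, rfl⟩ := Finset.mem_image.1 hw
  have h0 := Int.emod_nonneg (z - M - 1) hK'.ne'
  have h1 := Int.emod_lt_of_pos (z - M - 1) hK'
  have h2 : (0 : ℤ) ≤ K * j := by positivity
  have h3 : (K : ℤ) * j ≤ K * U.card :=
    mul_le_mul_of_nonneg_left (by have := Finset.mem_range.1 hj; omega) hK'.le
  refine ⟨g j, hwU, ⟨?_, fun d hd => ?_⟩, ?_⟩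
  · have : z - g j = K * ((z - M - 1) / K - j) := by
      have := Int.emod_add_mul_ediv (z - M - 1) K
      simp only [hg]
      linarith
    exact (Int.modEq_iff_dvd.2 ⟨_, this⟩).symm
  · simp only [hg]
    omega
  · zify
    rw [abs_of_nonneg (by simp only [hg]; omega)]
    simp only [hg]
    linarith

theorem exists_small (hK : 0 < K) (U : Finset ℤ) (hz : z ∉ U) :
    ∃ w ∉ U, Indist M K z w ∧ w.natAbs ≤ M + K * (U.card + 1) := by
  rcases lt_or_ge (M : ℤ) z with h | h
  · exact exists_small_of_pos hK U h
  rcases lt_or_ge (M : ℤ) (-z) with h' | h'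
  · obtain ⟨w, hw, hzw, hb⟩ := exists_small_of_pos hK (U.image Neg.neg) h'
    rw [Finset.card_image_of_injective _ neg_injective] at hb
    refine ⟨-w, fun hU => hw (Finset.mem_image.2 ⟨-w, hU, neg_neg w⟩), ?_, by simpa using hb⟩
    simpa using hzw.neg
  · exact ⟨z, hz, refl z, by omega⟩

end Indist

/-- A permutation of the integers which replaces integers by indistinguishable ones. -/
def IsTame (M K : ℕ) (π : Equiv.Perm ℤ) : Prop := ∀ z, Indist M K z (π z)

namespace IsTame

variable {M K : ℕ} {π ρ : Equiv.Perm ℤ}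

theorem one : IsTame M K 1 := fun z => Indist.refl z

theorem mul (h : IsTame M K π) (h' : IsTame M K ρ) : IsTame M K (π * ρ) :=
  fun z => (h' z).trans (h (ρ z))

theorem inv (h : IsTame M K π) : IsTame M K π⁻¹ := fun z => by
  simpa using (h (π⁻¹ z)).symm

theorem swap {z w : ℤ} (h : Indist M K z w) : IsTame M K (Equiv.swap z w) := by
  intro x
  rw [Equiv.swap_apply_def]
  split_ifs with h₁ h₂
  · exact h₁ ▸ h
  · exact h₂ ▸ h.symm
  · exact Indist.refl x

/-- Finitely many integers can be made small by a tame permutation. -/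
theorem exists_compress (hK : 0 < K) (S : Finset ℤ) :
    ∃ π, IsTame M K π ∧ ∀ z ∈ S, (π z).natAbs ≤ M + K * (S.card + 1) := by
  classical
  induction S using Finset.induction_on with
  | empty => exact ⟨1, one, by simp⟩
  | insert z S hz ih =>
    obtain ⟨π, hπ, hb⟩ := ih
    have hU : π z ∉ S.image π := by simpa using hz
    obtain ⟨w, hw, hzw, hwb⟩ := Indist.exists_small hK _ hU
    rw [Finset.card_image_of_injective _ π.injective] at hwb
    rw [Finset.card_insert_of_notMem hz]
    -- Neither `π z` nor `w` lies in the image of `S`, so the swap leaves the values already made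
    -- small untouched.
    refine ⟨Equiv.swap (π z) w * π, (swap hzw).mul hπ, fun x hx => ?_⟩
    have hle : M + K * (S.card + 1) ≤ M + K * (S.card + 1 + 1) := by gcongr; omega
    rcases Finset.mem_insert.1 hx with rfl | hx
    · rw [Equiv.Perm.mul_apply, Equiv.swap_apply_left]
      exact hwb.trans hle
    · have hxz : π x ≠ π z := fun h => hz (π.injective h ▸ hx)
      have hxw : π x ≠ w := fun h => hw (h ▸ Finset.mem_image_of_mem π hx)
      rw [Equiv.Perm.mul_apply, Equiv.swap_apply_of_ne_of_ne hxz hxw]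
      exact (hb x hx).trans hle

end IsTame

/-! ### Renaming the values of a sequence -/

/-- Replace all values in a sequence of assignments by their images under `π`. -/
def renameValues {n : ℕ} (π : Equiv.Perm ℤ) (σ : List (Assignment n)) : List (Assignment n) :=
  σ.map fun a v => π (a v)

section renameValues

variable {n : ℕ}

@[simp]
theorem length_renameValues (π : Equiv.Perm ℤ) (σ : List (Assignment n)) :
    (renameValues π σ).length = σ.length := List.length_map ..

theorem renameValues_append (π : Equiv.Perm ℤ) (σ σ' : List (Assignment n)) :
    renameValues π (σ ++ σ') = renameValues π σ ++ renameValues π σ' := List.map_append ..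

theorem renameValues_take (π : Equiv.Perm ℤ) (m : ℕ) (σ : List (Assignment n)) :
    renameValues π (σ.take m) = (renameValues π σ).take m := List.map_take ..

theorem renameValues_mul (π ρ : Equiv.Perm ℤ) (σ : List (Assignment n)) :
    renameValues (π * ρ) σ = renameValues π (renameValues ρ σ) := by
  simp [renameValues]

theorem renameValues_inv_self (π : Equiv.Perm ℤ) (σ : List (Assignment n)) :
    renameValues π⁻¹ (renameValues π σ) = σ := by
  simp [renameValues, Function.comp_def]

theorem IsTame.renameValues_eq_self {M K : ℕ} {π : Equiv.Perm ℤ} (hπ : IsTame M K π)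
    {σ : List (Assignment n)} (hσ : ValuesBounded M σ) : renameValues π σ = σ := by
  refine (List.map_congr_left fun a ha => ?_).trans (List.map_id σ)
  funext v
  exact (hπ (a v)).eq_of_natAbs_le (hσ a ha v)

theorem getD_renameValues (π : Equiv.Perm ℤ) {σ : List (Assignment n)} {i : ℕ}
    (hi : i < σ.length) (v : Fin n) :
    (renameValues π σ).getD i 0 v = π (σ.getD i 0 v) := by
  simp [renameValues, hi]

/-- Sequences of assignments with few entries can be given small values by a tame permutation. -/
theorem IsTame.exists_valuesBounded {M K : ℕ} (hK : 0 < K) (σ : List (Assignment n)) {m : ℕ}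
    (hm : σ.length ≤ m) :
    ∃ π, IsTame M K π ∧ ValuesBounded (M + K * (m * n + 1)) (renameValues π σ) := by
  classical
  set S : Finset ℤ := (σ.flatMap List.ofFn).toFinset
  have hS : S.card ≤ m * n := by
    refine (List.toFinset_card_le _).trans ?_
    have : (σ.flatMap List.ofFn).length = σ.length * n := by
      simp [List.length_flatMap]
    rw [this]
    exact Nat.mul_le_mul_right n hm
  obtain ⟨π, hπ, hb⟩ := IsTame.exists_compress (M := M) hK S
  refine ⟨π, hπ, fun a ha v => ?_⟩
  obtain ⟨b, hbσ, rfl⟩ := List.mem_map.1 ha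
  refine (hb (b v) ?_).trans (by gcongr)
  simp only [S, List.mem_toFinset, List.mem_flatMap]
  exact ⟨b, hbσ, (List.mem_ofFn' _ _).2 ⟨v, rfl⟩⟩

end renameValues

/-! ### Invariance of satisfaction under tame renaming -/

theorem LExpr.lookahead_le_code {n : ℕ} : ∀ e : LExpr n, e.lookahead ≤ e.code
  | var v j => (Nat.right_le_pair v j).trans (Nat.right_le_pair 0 _)
  | const _ => Nat.zero_le _
  | add e₁ e₂ => (max_le ((lookahead_le_code e₁).trans (Nat.left_le_pair _ _))
      ((lookahead_le_code e₂).trans (Nat.right_le_pair _ _))).trans (Nat.right_le_pair 2 _)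
  | smul _ e => (lookahead_le_code e).trans ((Nat.right_le_pair _ _).trans (Nat.right_le_pair 3 _))

theorem LExpr.natAbs_le_code_const {n : ℕ} (d : ℤ) : d.natAbs ≤ (const d : LExpr n).code :=
  d.natAbs_le_encode.trans (Nat.right_le_pair 1 _)

theorem LConstraint.lookahead_le_code {n : ℕ} (C : LConstraint n) : C.lookahead ≤ C.code := by
  have key : ∀ (m : ℕ) (e₁ e₂ : LExpr n),
      max e₁.lookahead e₂.lookahead ≤ Nat.pair m (Nat.pair e₁.code e₂.code) := fun m e₁ e₂ =>
    (max_le (e₁.lookahead_le_code.trans (Nat.left_le_pair _ _))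
      (e₂.lookahead_le_code.trans (Nat.right_le_pair _ _))).trans (Nat.right_le_pair m _)
  cases C with
  | cong k e₁ e₂ | ncong k e₁ e₂ => exact (key k e₁ e₂).trans (Nat.right_le_pair _ _)
  | _ => exact key _ _ _

/-- Tame permutations do not change the truth of periodicity constraints. -/
theorem LConstraint.IsIPC.holds_renameValues {n M K : ℕ} {C : LConstraint n} (hC : C.IsIPC)
    (hM : C.code ≤ M) (hK : ∀ k, 0 < k → k ≤ C.code → k ∣ K) {π : Equiv.Perm ℤ}
    (hπ : IsTame M K π) {σ : List (Assignment n)} {i : ℕ} (hi : C.WellDefined σ i) :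
    C.Holds (renameValues π σ) i ↔ C.Holds σ i := by
  -- Constants and moduli are components of the code of `C`, hence bounded by it.
  have hd : ∀ {d m : ℕ} {e : LExpr n}, Nat.pair m (Nat.pair e.code (LExpr.const d : LExpr n).code)
      ≤ M → (d : ℤ).natAbs ≤ M := fun h =>
    (LExpr.natAbs_le_code_const _).trans ((Nat.right_le_pair _ _).trans
      ((Nat.right_le_pair _ _).trans h))
  have hk : ∀ {k x m : ℕ}, 0 < k → Nat.pair m (Nat.pair k x) = C.code → k ∣ K := fun h h' =>
    hK _ h (h' ▸ (Nat.left_le_pair _ _).trans (Nat.right_le_pair _ _))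
  cases hC with
  | var_eq_var x j y l =>
    simp only [WellDefined, LConstraint.lookahead, LExpr.lookahead] at hi
    simp only [Holds, LExpr.eval]
    -- Equality of two variables is the reason for using permutations: tameness alone would not
    -- prevent distinct values from being merged.
    rw [getD_renameValues π (by omega), getD_renameValues π (by omega), π.injective.eq_iff]
  | var_eq x j d =>
    simp only [WellDefined, LConstraint.lookahead, LExpr.lookahead] at hi
    simp only [Holds, LExpr.eval]
    rw [getD_renameValues π (by omega)]
    exact ((hπ _).eq_iff (hd hM)).symm
  | var_ne x j d =>
    simp only [WellDefined, LConstraint.lookahead, LExpr.lookahead] at hi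
    simp only [Holds, LExpr.eval]
    rw [getD_renameValues π (by omega)]
    exact ((hπ _).eq_iff (hd hM)).symm.not
  | var_lt x j d =>
    simp only [WellDefined, LConstraint.lookahead, LExpr.lookahead] at hi
    simp only [Holds, LExpr.eval]
    rw [getD_renameValues π (by omega)]
    exact ((hπ _).lt_iff (hd hM)).symm
  | var_gt x j d =>
    simp only [WellDefined, LConstraint.lookahead, LExpr.lookahead] at hi
    simp only [Holds, LExpr.eval]
    rw [getD_renameValues π (by omega)]
    refine ((hπ _).gt_iff ?_).symm
    exact (LExpr.natAbs_le_code_const _).trans ((Nat.left_le_pair _ _).trans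
      ((Nat.right_le_pair _ _).trans hM))
  | cong_var k hk0 x j y l d =>
    simp only [WellDefined, LConstraint.lookahead, LExpr.lookahead] at hi
    simp only [Holds, LExpr.eval]
    rw [getD_renameValues π (by omega), getD_renameValues π (by omega)]
    have hkK : (k : ℤ) ∣ K := by exact_mod_cast hk hk0 rfl
    have h₁ := ((hπ (σ.getD (i + j) 0 x)).1.of_dvd hkK)
    have h₂ := ((hπ (σ.getD (i + l) 0 y)).1.of_dvd hkK).add_right d
    exact ⟨fun h => h₁.trans (h.trans h₂.symm), fun h => h₁.symm.trans (h.trans h₂)⟩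
  | cong_const k hk0 x j d =>
    simp only [WellDefined, LConstraint.lookahead, LExpr.lookahead] at hi
    simp only [Holds, LExpr.eval]
    rw [getD_renameValues π (by omega)]
    have h₁ := ((hπ (σ.getD (i + j) 0 x)).1.of_dvd (by exact_mod_cast hk hk0 rfl : (k : ℤ) ∣ K))
    exact ⟨fun h => h₁.trans h, fun h => h₁.symm.trans h⟩

/-- Renaming keeps the length, so the temporal operators and the well-definedness of atoms are
unaffected. Atoms that are not well-defined hold on both sides at every instant of the sequence, by
the weak semantics. -/
theorem LProp.satAt_renameValues {n c M K : ℕ} (hM : c ≤ M) (hK : ∀ k, 0 < k → k ≤ c → k ∣ K)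
    {π : Equiv.Perm ℤ} (hπ : IsTame M K π) (σ : List (Assignment n)) :
    ∀ {φ : LProp n}, φ.IsIPC → φ.code ≤ c → ∀ i,
      (φ.SatAt (renameValues π σ) i ↔ φ.SatAt σ i)
  | atom C, hφ, hc, i => by
    have hC : C.code ≤ c := (Nat.right_le_pair _ _).trans hc
    simp only [SatAt, length_renameValues, LConstraint.WellDefined]
    by_cases hi : i + C.lookahead < σ.length
    · rw [LConstraint.IsIPC.holds_renameValues hφ (hC.trans hM)
        (fun k hk h => hK k hk (h.trans hC)) hπ hi]
    · simp [hi]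
  | and φ₁ φ₂, hφ, hc, i => by
    have hc' := (Nat.right_le_pair _ _).trans hc
    exact and_congr
      (satAt_renameValues hM hK hπ σ hφ.1 ((Nat.left_le_pair _ _).trans hc') i)
      (satAt_renameValues hM hK hπ σ hφ.2 ((Nat.right_le_pair _ _).trans hc') i)
  | not φ, hφ, hc, i =>
    not_congr (satAt_renameValues hM hK hπ σ (φ := φ) hφ ((Nat.right_le_pair _ _).trans hc) i)
  | next φ, hφ, hc, i => by
    simp only [SatAt, length_renameValues]
    rw [satAt_renameValues hM hK hπ σ (φ := φ) hφ ((Nat.right_le_pair _ _).trans hc) (i + 1)]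
  | untl φ₁ φ₂, hφ, hc, i => by
    have hc' := (Nat.right_le_pair _ _).trans hc
    have h₁ := satAt_renameValues hM hK hπ σ hφ.1 ((Nat.left_le_pair _ _).trans hc')
    have h₂ := satAt_renameValues hM hK hπ σ hφ.2 ((Nat.right_le_pair _ _).trans hc')
    simp only [SatAt, length_renameValues, h₁, h₂]

/-! ### Equivalence of suffixes -/

theorem LExpr.eval_cons_succ {n : ℕ} (a : Assignment n) (σ : List (Assignment n)) (i : ℕ) :
    ∀ e : LExpr n, e.eval (a :: σ) (i + 1) = e.eval σ i
  | var v j => by simp [eval, Nat.add_right_comm i 1 j]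
  | const _ => rfl
  | add e₁ e₂ => by simp [eval, eval_cons_succ a σ i e₁, eval_cons_succ a σ i e₂]
  | smul k e => by simp [eval, eval_cons_succ a σ i e]

/-- Satisfaction at an instant depends only on the sequence from this instant on. -/
theorem LProp.satAt_cons_succ {n : ℕ} (a : Assignment n) (σ : List (Assignment n)) :
    ∀ (φ : LProp n) (i : ℕ), φ.SatAt (a :: σ) (i + 1) ↔ φ.SatAt σ i
  | atom C, i => by
    have : C.Holds (a :: σ) (i + 1) ↔ C.Holds σ i := by
      cases C <;> simp [LConstraint.Holds, LExpr.eval_cons_succ]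
    simp only [SatAt, this, LConstraint.WellDefined, List.length_cons]
    rw [Nat.add_right_comm, Nat.add_lt_add_iff_right, Nat.add_lt_add_iff_right]
  | and φ₁ φ₂, i => and_congr (satAt_cons_succ a σ φ₁ i) (satAt_cons_succ a σ φ₂ i)
  | not φ, i => not_congr (satAt_cons_succ a σ φ i)
  | next φ, i => by simp [SatAt, satAt_cons_succ a σ φ (i + 1)]
  | untl φ₁ φ₂, i => by
    simp only [SatAt]
    constructor
    · rintro ⟨j, hij, hj, h₂, h₁⟩
      obtain ⟨j, rfl⟩ := Nat.exists_eq_add_of_lt (Nat.lt_of_lt_of_le (Nat.succ_pos i) hij)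
      rw [Nat.zero_add] at *
      refine ⟨j, by omega, by simpa using hj, (satAt_cons_succ a σ φ₂ j).1 h₂, fun k hk hkj => ?_⟩
      exact (satAt_cons_succ a σ φ₁ k).1 (h₁ (k + 1) (by omega) (by omega))
    · rintro ⟨j, hij, hj, h₂, h₁⟩
      refine ⟨j + 1, by omega, by simpa using hj, (satAt_cons_succ a σ φ₂ j).2 h₂,
        fun k hk hkj => ?_⟩
      obtain ⟨k, rfl⟩ := Nat.exists_eq_add_of_lt (Nat.lt_of_lt_of_le (Nat.succ_pos i) hk)
      rw [Nat.zero_add] at *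
      exact (satAt_cons_succ a σ φ₁ k).2 (h₁ k (by omega) (by omega))

theorem LExpr.eval_take {n m : ℕ} (σ : List (Assignment n)) :
    ∀ {e : LExpr n}, e.lookahead < m → e.eval (σ.take m) 0 = e.eval σ 0
  | var v j, h => by
    have h : j < m := h
    simp [eval, List.getD_eq_getElem?_getD, h]
  | const _, _ => rfl
  | add e₁ e₂, h => by
    have h : max e₁.lookahead e₂.lookahead < m := h
    rw [eval, eval, eval_take σ (by omega), eval_take σ (by omega)]
  | smul k e, h => by
    rw [eval, eval, eval_take σ (e := e) h]

theorem LProp.sat_atom_take {n m : ℕ} (σ : List (Assignment n)) {C : LConstraint n}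
    (h : C.lookahead < m) : (atom C).Sat (σ.take m) ↔ (atom C).Sat σ := by
  have : C.Holds (σ.take m) 0 ↔ C.Holds σ 0 := by
    cases C <;> simp only [LConstraint.lookahead, max_lt_iff] at h <;>
      simp [LConstraint.Holds, LExpr.eval_take σ h.1, LExpr.eval_take σ h.2]
  simp only [Sat, SatAt, this, LConstraint.WellDefined, List.length_take]
  have h₁ : 0 < min m σ.length ↔ 0 < σ.length := by omega
  have h₂ : 0 + C.lookahead < min m σ.length ↔ 0 + C.lookahead < σ.length := by omega
  rw [h₁, h₂]

/-- Two sequences agree on their first `c + 1` instants and on all periodicity properties with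
codes at most `c`. -/
def SuffixEquiv {n : ℕ} (c : ℕ) (σ σ' : List (Assignment n)) : Prop :=
  σ.take (c + 1) = σ'.take (c + 1) ∧
    ∀ φ : LProp n, φ.IsIPC → φ.code ≤ c → (φ.Sat σ ↔ φ.Sat σ')

theorem LProp.sat_untl_cons {n : ℕ} (a : Assignment n) (σ : List (Assignment n))
    (φ₁ φ₂ : LProp n) : (untl φ₁ φ₂).Sat (a :: σ) ↔
      φ₂.Sat (a :: σ) ∨ (0 < σ.length ∧ φ₁.Sat (a :: σ) ∧ (untl φ₁ φ₂).Sat σ) := by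
  simp only [Sat]
  rw [satAt_untl_iff, satAt_cons_succ]
  simp

theorem LProp.sat_next_cons {n : ℕ} (a : Assignment n) (σ : List (Assignment n)) (φ : LProp n) :
    (next φ).Sat (a :: σ) ↔ 0 < σ.length ∧ φ.Sat σ := by
  simp only [Sat, SatAt]
  rw [satAt_cons_succ]
  simp

/-- An atom at the new head sees only the window of `c + 1` instants. The temporal operators reduce,
by their unfoldings, to the head and to properties of the tail whose codes are still at most `c`. -/
theorem SuffixEquiv.cons {n c : ℕ} {σ σ' : List (Assignment n)} (h : SuffixEquiv c σ σ')
    (a : Assignment n) : SuffixEquiv c (a :: σ) (a :: σ') := by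
  have ht : (a :: σ).take (c + 1) = (a :: σ').take (c + 1) := by
    -- The new head takes one place of the window, so only `c` instants of the tails are needed.
    have := congrArg (List.take c) h.1
    rw [List.take_take, List.take_take, min_eq_left (Nat.le_succ c)] at this
    rw [List.take_succ_cons, List.take_succ_cons, this]
  -- The window has at least one place, so it shows whether the tail is empty.
  have hl : 0 < σ.length ↔ 0 < σ'.length := by
    have := congrArg List.length h.1
    rw [List.length_take, List.length_take] at this
    omega
  refine ⟨ht, fun φ => ?_⟩
  induction φ with
  | atom C =>
    intro _ hc
    have hC : C.lookahead < c + 1 :=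
      Nat.lt_succ_of_le (C.lookahead_le_code.trans ((Nat.right_le_pair _ _).trans hc))
    rw [← LProp.sat_atom_take (a :: σ) hC, ht, LProp.sat_atom_take (a :: σ') hC]
  | and φ₁ φ₂ ih₁ ih₂ =>
    intro hφ hc
    have hc' := (Nat.right_le_pair _ _).trans hc
    exact and_congr (ih₁ hφ.1 ((Nat.left_le_pair _ _).trans hc'))
      (ih₂ hφ.2 ((Nat.right_le_pair _ _).trans hc'))
  | not φ ih =>
    intro hφ hc
    exact not_congr (ih hφ ((Nat.right_le_pair _ _).trans hc))
  | next φ ih =>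
    intro hφ hc
    rw [LProp.sat_next_cons, LProp.sat_next_cons, hl,
      h.2 φ hφ ((Nat.right_le_pair _ _).trans hc)]
  | untl φ₁ φ₂ ih₁ ih₂ =>
    intro hφ hc
    have hc' := (Nat.right_le_pair _ _).trans hc
    rw [LProp.sat_untl_cons, LProp.sat_untl_cons, hl, h.2 _ hφ hc,
      ih₁ hφ.1 ((Nat.left_le_pair _ _).trans hc'), ih₂ hφ.2 ((Nat.right_le_pair _ _).trans hc')]

theorem SuffixEquiv.append {n c : ℕ} {σ σ' : List (Assignment n)} (h : SuffixEquiv c σ σ') :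
    ∀ ρ : List (Assignment n), SuffixEquiv c (ρ ++ σ) (ρ ++ σ')
  | [] => h
  | a :: ρ => (h.append ρ).cons a

/-! ### Short and small continuations -/

/-- A bound for the number of suffixes up to `SuffixEquiv c` and tame permutations. -/
def stateBound (n c M : ℕ) : ℕ :=
  (traceCodeBound n (M + c.factorial * ((c + 1) * n + 1)) (c + 1) + 1) * 2 ^ (c + 1)

/-- A bound for the code of the shortest continuation which satisfies a property. -/
def continuationBound (n c t : ℕ) : ℕ :=
  traceCodeBound n (c + t + c.factorial * ((t + stateBound n c (c + t)) * n + 1))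
    (stateBound n c (c + t))

/-- Pigeonhole: each suffix is sent to the code of its compressed window, paired with the set of
codes at most `c` of the IPC properties it satisfies. `stateBound` counts the possible pairs. -/
theorem exists_renameValues_suffixEquiv {n c M : ℕ} (hM : c ≤ M)
    (σ : List (Assignment n)) (hσ : stateBound n c M < σ.length) :
    ∃ i j π, i < j ∧ j < σ.length ∧ SuffixEquiv c (σ.drop i) (renameValues π (σ.drop j)) := by
  classical
  -- The factorial serves as a common multiple of all moduli that can occur.
  have hK : ∀ k, 0 < k → k ≤ c → k ∣ c.factorial := fun k hk h => Nat.dvd_factorial hk h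
  have hex : ∀ ρ : List (Assignment n), ∃ π, IsTame M c.factorial π ∧
      ValuesBounded (M + c.factorial * ((c + 1) * n + 1)) (renameValues π (ρ.take (c + 1))) :=
    fun ρ => IsTame.exists_valuesBounded c.factorial_pos _ (by simp)
  choose p hp hpb using hex
  set state : ℕ → ℕ × Finset ℕ := fun i =>
    (Encodable.encode (renameValues (p (σ.drop i)) ((σ.drop i).take (c + 1))),
      (Finset.range (c + 1)).filter fun m =>
        ∃ φ : LProp n, φ.IsIPC ∧ φ.code = m ∧ φ.Sat (σ.drop i)) with hstate
  set T : Finset (ℕ × Finset ℕ) :=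
    Finset.range (traceCodeBound n (M + c.factorial * ((c + 1) * n + 1)) (c + 1) + 1) ×ˢ
      (Finset.range (c + 1)).powerset with hT
  have hcard : T.card = stateBound n c M := by
    simp [hT, stateBound, Finset.card_powerset]
  have hmaps : Set.MapsTo state (Finset.range σ.length) T := by
    intro i _
    rw [Finset.mem_coe, hT, Finset.mem_product]
    refine ⟨Finset.mem_range.2 (Nat.lt_succ_of_le ?_), Finset.mem_powerset.2 (Finset.filter_subset ..)⟩
    exact encode_le_traceCodeBound (hpb _) (by simp)
  obtain ⟨i, hi, j, hj, hne, heq⟩ := Finset.exists_ne_map_eq_of_card_lt_of_maps_to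
    (by rw [hcard, Finset.card_range]; exact hσ) hmaps
  wlog hij : i < j generalizing i j
  · exact this j hj i hi hne.symm heq.symm (by omega)
  have h₁ := Encodable.encode_injective (congrArg Prod.fst heq)
  have h₂ := congrArg Prod.snd heq
  -- Compressing the window at `j` and decompressing as at `i` carries the one window exactly onto
  -- the other.
  have htame := (hp (σ.drop i)).inv.mul (hp (σ.drop j))
  refine ⟨i, j, (p (σ.drop i))⁻¹ * p (σ.drop j), hij, Finset.mem_range.1 hj, ?_, fun φ hφ hc => ?_⟩
  · rw [← renameValues_take, renameValues_mul, ← h₁, renameValues_inv_self]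
  · rw [LProp.Sat, LProp.Sat, LProp.satAt_renameValues hM hK htame _ hφ hc]
    have key : ∀ i, φ.code ∈ (state i).2 ↔ φ.Sat (σ.drop i) := by
      intro i
      simp only [hstate, Finset.mem_filter, Finset.mem_range, Nat.lt_succ_of_le hc, true_and]
      exact ⟨fun ⟨φ', _, h, hs⟩ => LProp.code_injective h ▸ hs, fun h => ⟨φ, hφ, rfl, h⟩⟩
    exact (key i).symm.trans ((iff_of_eq (congrArg (φ.code ∈ ·) h₂)).trans (key j))

/-- Satisfying continuations can be chosen short. -/
theorem exists_short_continuation {n c M : ℕ} (hM : c ≤ M) {ψ : LProp n} (hψ : ψ.IsIPC)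
    (hc : ψ.code ≤ c) (τ : List (Assignment n)) :
    ∀ τ' : List (Assignment n), τ' ≠ [] → ψ.Sat (τ ++ τ') →
      ∃ ρ, ρ ≠ [] ∧ ρ.length ≤ stateBound n c M ∧ ψ.Sat (τ ++ ρ) := by
  intro τ'
  induction h : τ'.length using Nat.strong_induction_on generalizing τ' with
  | _ m ih =>
    intro hne hs
    subst h
    rcases le_or_gt τ'.length (stateBound n c M) with hl | hl
    · exact ⟨τ', hne, hl, hs⟩
    obtain ⟨i, j, π, hij, hj, hequiv⟩ := exists_renameValues_suffixEquiv hM τ' hl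
    have hlen : (τ'.take i ++ renameValues π (τ'.drop j)).length = i + (τ'.length - j) := by
      rw [List.length_append, List.length_take, length_renameValues, List.length_drop]
      omega
    -- Cut out the instants from `i` up to `j` and rename only what follows; what precedes the cut,
    -- including `τ`, keeps its values. The result is nonempty because `j < τ'.length`.
    refine ih _ (by omega) (τ'.take i ++ renameValues π (τ'.drop j)) rfl ?_ ?_
    · rw [← List.length_pos_iff]
      omega
    · rw [← List.append_assoc]
      refine ((hequiv.append (τ ++ τ'.take i)).2 ψ hψ hc).1 ?_
      rwa [List.append_assoc, List.take_append_drop]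

/-- Satisfying continuations can be chosen with a small code. -/
theorem exists_small_continuation {n : ℕ} {ψ : LProp n} (hψ : ψ.IsIPC) {τ τ' : List (Assignment n)}
    (hne : τ' ≠ []) (hs : ψ.Sat (τ ++ τ')) :
    ∃ ρ : List (Assignment n), ρ ≠ [] ∧ ψ.Sat (τ ++ ρ) ∧
      Encodable.encode ρ ≤ continuationBound n ψ.code (Encodable.encode τ) := by
  set c := ψ.code
  set t := Encodable.encode τ
  obtain ⟨ρ, hρ, hl, hs⟩ :=
    exists_short_continuation (Nat.le_add_right c t) hψ le_rfl τ τ' hne hs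
  -- The threshold `c + t` exceeds both the constants of `ψ` and the absolute values in `τ`, so `π`
  -- respects `ψ` and fixes `τ`.
  obtain ⟨π, hπ, hb⟩ := IsTame.exists_valuesBounded (M := c + t) c.factorial_pos (τ ++ ρ)
    (m := t + stateBound n c (c + t))
    (by rw [List.length_append]; exact Nat.add_le_add (encode_list_length_le τ) hl)
  have hτ : renameValues π τ = τ := hπ.renameValues_eq_self fun a ha v =>
    (valuesBounded_encode τ a ha v).trans (Nat.le_add_left _ _)
  refine ⟨renameValues π ρ, ?_, ?_, ?_⟩
  · rwa [← List.length_pos_iff, length_renameValues, List.length_pos_iff]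
  · have := (LProp.satAt_renameValues (Nat.le_add_right c t)
      (fun k hk h => Nat.dvd_factorial hk h) hπ (τ ++ ρ) hψ le_rfl 0).2 hs
    rwa [renameValues_append, hτ] at this
  · refine encode_le_traceCodeBound (fun a ha v => hb a ?_ v) (by simpa using hl)
    rw [renameValues_append]
    exact List.mem_append_right _ ha

/-! ### Primitive recursiveness of the bounds -/

theorem primrec_factorial : Primrec Nat.factorial := by
  have : Primrec (Nat.rec 1 (fun m r => (m + 1) * r) : ℕ → ℕ) :=
    Primrec.nat_rec₁ 1 (Primrec.nat_mul.comp₂ (Primrec.succ.comp₂ Primrec₂.left) Primrec₂.right)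
  refine this.of_eq fun m => ?_
  induction m with
  | zero => rfl
  | succ m ih => exact congrArg ((m + 1) * ·) ih

theorem primrec_two_pow : Primrec fun m : ℕ => 2 ^ m :=
  (Primrec₂.unpaired'.1 Nat.Primrec.pow).comp (Primrec.const 2) Primrec.id

theorem primrec₂_listCodeBound : Primrec₂ listCodeBound := by
  have := Primrec.nat_rec (f := fun _ : ℕ => 0) (g := fun B p => Nat.succ (Nat.pair B p.2))
    (Primrec.const 0)
    (Primrec.succ.comp₂ (Primrec₂.natPair.comp₂ Primrec₂.left (Primrec.snd.comp₂ Primrec₂.right)))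
  refine this.of_eq fun B m => ?_
  induction m with
  | zero => rfl
  | succ m ih => exact congrArg (fun r => Nat.succ (Nat.pair B r)) ih

theorem primrec₂_traceCodeBound (n : ℕ) : Primrec₂ (traceCodeBound n) :=
  primrec₂_listCodeBound.comp₂
    (primrec₂_listCodeBound.comp₂
      (Primrec.nat_mul.comp₂ (Primrec₂.const 2) Primrec₂.left) (Primrec₂.const n))
    Primrec₂.right

theorem primrec₂_stateBound (n : ℕ) : Primrec₂ (stateBound n) := by
  have hc : Primrec₂ fun c _ : ℕ => c + 1 := Primrec.succ.comp₂ Primrec₂.left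
  exact Primrec.nat_mul.comp₂ (Primrec.succ.comp₂ ((primrec₂_traceCodeBound n).comp₂
    (Primrec.nat_add.comp₂ Primrec₂.right (Primrec.nat_mul.comp₂
      (primrec_factorial.comp₂ Primrec₂.left)
      (Primrec.succ.comp₂ (Primrec.nat_mul.comp₂ hc (Primrec₂.const n))))) hc))
    (primrec_two_pow.comp₂ hc)

theorem primrec₂_continuationBound (n : ℕ) : Primrec₂ (continuationBound n) := by
  have hct : Primrec₂ fun c t : ℕ => c + t := Primrec.nat_add
  have hs : Primrec₂ fun c t : ℕ => stateBound n c (c + t) :=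
    (primrec₂_stateBound n).comp₂ Primrec₂.left hct
  exact (primrec₂_traceCodeBound n).comp₂ (Primrec.nat_add.comp₂ hct (Primrec.nat_mul.comp₂
    (primrec_factorial.comp₂ Primrec₂.left) (Primrec.succ.comp₂ (Primrec.nat_mul.comp₂
      (Primrec.nat_add.comp₂ Primrec₂.right hs) (Primrec₂.const n))))) hs

/-! ### Evaluating constraints on codes -/

/-- The code of the value of the variable with number `v` at instant `i`. -/
def valueCode {n : ℕ} (τ : List (Assignment n)) (v i : ℕ) : ℕ :=
  (((τ[i]?).map fun a => List.ofFn fun v => Encodable.encode (a v)).getD [])[v]?.getD 0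

theorem valueCode_eq {n : ℕ} (τ : List (Assignment n)) (v : Fin n) (i : ℕ) :
    valueCode τ v i = Encodable.encode (τ.getD i 0 v) := by
  rw [valueCode, List.getD_eq_getElem?_getD]
  cases τ[i]? with
  -- Outside the sequence both sides use the default `0`, and the integer `0` has code `0`.
  | none => rfl
  | some a => simp

/-- The code of the value of the variable or constant with code `e` at instant `i`. -/
def termCode {n : ℕ} (τ : List (Assignment n)) (i e : ℕ) : ℕ :=
  if e.unpair.1 = 0 then valueCode τ e.unpair.2.unpair.1 (i + e.unpair.2.unpair.2)
  else e.unpair.2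

theorem termCode_var {n : ℕ} (τ : List (Assignment n)) (i : ℕ) (v : Fin n) (j : ℕ) :
    termCode τ i (LExpr.var v j).code = Encodable.encode ((LExpr.var v j).eval τ i) := by
  simp [termCode, LExpr.code, LExpr.eval, valueCode_eq]

theorem termCode_const {n : ℕ} (τ : List (Assignment n)) (i d : ℕ) :
    termCode τ i (LExpr.const d : LExpr n).code = 2 * d := by
  simp [termCode, LExpr.code, encode_intCast]

/-- The lookahead of the variable or constant with code `e`. -/
def termLookahead (e : ℕ) : ℕ := if e.unpair.1 = 0 then e.unpair.2.unpair.2 else 0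

/-- The lookahead of the expression with code `e`, which is a variable, a constant or a sum of
those. -/
def exprLookahead (e : ℕ) : ℕ :=
  if e.unpair.1 = 2 then
    max (termLookahead e.unpair.2.unpair.1) (termLookahead e.unpair.2.unpair.2)
  else termLookahead e

theorem exprLookahead_var {n : ℕ} (v : Fin n) (j : ℕ) :
    exprLookahead (LExpr.var v j).code = j := by
  simp [exprLookahead, termLookahead, LExpr.code]

theorem exprLookahead_const {n : ℕ} (d : ℤ) :
    exprLookahead (LExpr.const d : LExpr n).code = 0 := by
  simp [exprLookahead, termLookahead, LExpr.code]

theorem exprLookahead_add {n : ℕ} (v : Fin n) (j : ℕ) (d : ℤ) :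
    exprLookahead (LExpr.add (.var v j) (.const d)).code = j := by
  simp [exprLookahead, termLookahead, LExpr.code]

/-- The remainder modulo `k` of the integer with code `z`. -/
def codeMod (k z : ℕ) : ℕ :=
  if z % 2 = 0 then (z / 2) % k else (k - (z / 2 + 1) % k) % k

theorem codeMod_encode {k : ℕ} (hk : 0 < k) (z : ℤ) :
    (codeMod k (Encodable.encode z) : ℤ) = z % k := by
  obtain ⟨d, rfl⟩ | ⟨d, rfl⟩ : (∃ d : ℕ, z = d) ∨ ∃ d : ℕ, z = Int.negSucc d := by
    cases z with
    | ofNat d => exact Or.inl ⟨d, rfl⟩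
    | negSucc d => exact Or.inr ⟨d, rfl⟩
  · simp [encode_intCast, codeMod]
  · have h₁ : (2 * d + 1) % 2 ≠ 0 := by omega
    have h₂ : (2 * d + 1) / 2 = d := by omega
    rw [encode_negSucc, codeMod, if_neg h₁, h₂, Int.natCast_mod,
      Nat.cast_sub (Nat.mod_lt _ hk).le, Int.natCast_mod, Int.negSucc_eq]
    push_cast
    refine Int.modEq_iff_dvd.2 ⟨-((d + 1) / k) - 1, ?_⟩
    have := Int.emod_add_mul_ediv ((d : ℤ) + 1) k
    linarith

/-- The remainder modulo `k` of the value of the expression with code `e`, which is a variable, a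
constant or a sum of those. -/
def exprMod {n : ℕ} (τ : List (Assignment n)) (i k e : ℕ) : ℕ :=
  if e.unpair.1 = 2 then
    (codeMod k (termCode τ i e.unpair.2.unpair.1) +
      codeMod k (termCode τ i e.unpair.2.unpair.2)) % k
  else codeMod k (termCode τ i e)

theorem exprMod_var {n k : ℕ} (hk : 0 < k) (τ : List (Assignment n)) (i : ℕ) (v : Fin n) (j : ℕ) :
    (exprMod τ i k (LExpr.var v j).code : ℤ) = (LExpr.var v j).eval τ i % k := by
  rw [exprMod, if_neg (by simp [LExpr.code]), termCode_var, codeMod_encode hk]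

theorem exprMod_const {n k : ℕ} (hk : 0 < k) (τ : List (Assignment n)) (i d : ℕ) :
    (exprMod τ i k (LExpr.const d : LExpr n).code : ℤ) = d % k := by
  rw [exprMod, if_neg (by simp [LExpr.code]), termCode_const, ← encode_intCast, codeMod_encode hk]

theorem exprMod_add {n k : ℕ} (hk : 0 < k) (τ : List (Assignment n)) (i : ℕ) (v : Fin n)
    (j d : ℕ) : (exprMod τ i k (LExpr.add (.var v j) (.const d)).code : ℤ) =
      ((LExpr.var v j).eval τ i + d) % k := by
  have h : ((LExpr.add (.var v j) (.const d)).code).unpair =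
      (2, Nat.pair (LExpr.var v j).code (LExpr.const d : LExpr n).code) := by
    simp [LExpr.code]
  rw [exprMod, h, if_pos rfl, Nat.unpair_pair, termCode_var, termCode_const, ← encode_intCast]
  push_cast
  rw [codeMod_encode hk, codeMod_encode hk, ← Int.add_emod]

/-- The lookahead of the periodicity constraint with code `C`. -/
def constraintLookahead (C : ℕ) : ℕ :=
  if C.unpair.1 = 4 then
    max (exprLookahead C.unpair.2.unpair.2.unpair.1) (exprLookahead C.unpair.2.unpair.2.unpair.2)
  else max (exprLookahead C.unpair.2.unpair.1) (exprLookahead C.unpair.2.unpair.2)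

theorem constraintLookahead_code {n : ℕ} {C : LConstraint n} (hC : C.IsIPC) :
    constraintLookahead C.code = C.lookahead := by
  cases hC <;>
    simp [constraintLookahead, LConstraint.code, LConstraint.lookahead, LExpr.lookahead,
      exprLookahead_var, exprLookahead_const, exprLookahead_add]

/-- The periodicity constraint with code `C` holds at instant `i`. -/
def CodeHolds {n : ℕ} (τ : List (Assignment n)) (i C : ℕ) : Prop :=
  let p := C.unpair.2.unpair.1
  let q := C.unpair.2.unpair.2
  (C.unpair.1 = 0 ∧ termCode τ i p = termCode τ i q) ∨
  (C.unpair.1 = 1 ∧ ¬ termCode τ i p = termCode τ i q) ∨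
  (C.unpair.1 = 2 ∧ p.unpair.1 = 0 ∧
    (termCode τ i p % 2 = 1 ∨ termCode τ i p < termCode τ i q)) ∨
  (C.unpair.1 = 2 ∧ ¬ p.unpair.1 = 0 ∧
    (termCode τ i q % 2 = 0 ∧ termCode τ i p < termCode τ i q)) ∨
  (C.unpair.1 = 4 ∧ exprMod τ i p q.unpair.1 = exprMod τ i p q.unpair.2)

/-- Negative integers have odd codes and a natural number `d` has code `2 * d`, so comparison with a
natural constant needs only parity and the order of codes. -/
theorem encode_int_lt_iff (z : ℤ) (d : ℕ) :
    (Encodable.encode z % 2 = 1 ∨ Encodable.encode z < 2 * d) ↔ z < d := by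
  cases z with
  | ofNat m =>
    rw [Int.ofNat_eq_natCast, encode_intCast]
    omega
  | negSucc m =>
    rw [encode_negSucc]
    have := Int.negSucc_lt_zero m
    omega

theorem lt_encode_int_iff (z : ℤ) (d : ℕ) :
    (Encodable.encode z % 2 = 0 ∧ 2 * d < Encodable.encode z) ↔ d < z := by
  cases z with
  | ofNat m =>
    rw [Int.ofNat_eq_natCast, encode_intCast]
    omega
  | negSucc m =>
    rw [encode_negSucc]
    have := Int.negSucc_lt_zero m
    omega

theorem codeHolds_code {n : ℕ} {C : LConstraint n} (hC : C.IsIPC) (τ : List (Assignment n))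
    (i : ℕ) : CodeHolds τ i C.code ↔ C.Holds τ i := by
  cases hC with
  | var_eq_var x j y l =>
    simp [CodeHolds, LConstraint.code, LConstraint.Holds, termCode_var]
  | var_eq x j d =>
    simp [CodeHolds, LConstraint.code, LConstraint.Holds, termCode_var, termCode_const,
      ← encode_intCast, LExpr.eval]
  | var_ne x j d =>
    simp [CodeHolds, LConstraint.code, LConstraint.Holds, termCode_var, termCode_const,
      ← encode_intCast, LExpr.eval]
  | var_lt x j d =>
    have h : (LExpr.var x j).code.unpair.1 = 0 := by simp [LExpr.code]
    simp [CodeHolds, LConstraint.code, LConstraint.Holds, termCode_var, termCode_const, h,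
      encode_int_lt_iff]
    rfl
  | var_gt x j d =>
    have h : (LExpr.const d : LExpr n).code.unpair.1 = 1 := by simp [LExpr.code]
    simp [CodeHolds, LConstraint.code, LConstraint.Holds, termCode_var, termCode_const, h,
      lt_encode_int_iff]
    rfl
  | cong_var k hk x j y l d =>
    simp only [CodeHolds, LConstraint.code, LConstraint.Holds, Nat.unpair_pair,
      OfNat.ofNat_ne_zero, Nat.reduceEqDiff, OfNat.ofNat_ne_one,
      false_and, false_or, true_and]
    rw [← Int.natCast_inj, exprMod_var hk, exprMod_add hk]
    simp [Int.ModEq, LExpr.eval]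
  | cong_const k hk x j d =>
    simp only [CodeHolds, LConstraint.code, LConstraint.Holds, Nat.unpair_pair,
      OfNat.ofNat_ne_zero, Nat.reduceEqDiff, OfNat.ofNat_ne_one,
      false_and, false_or, true_and]
    rw [← Int.natCast_inj, exprMod_var hk, exprMod_const hk]
    simp [Int.ModEq, LExpr.eval]

/-! ### Truth tables indexed by codes -/

/-- The entry of a table of truth values in row `x` and column `i` is `true`. -/
def EntryTrue (T : List (List Bool)) (x i : ℕ) : Prop := (T[x]?.getD [])[i]? = some true

/-- The property with code `T.length` holds at instant `i`, where the rows of `T` are the truth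
values of the properties with smaller codes. -/
def StepTrue {n : ℕ} (τ : List (Assignment n)) (T : List (List Bool)) (i : ℕ) : Prop :=
  let t := T.length.unpair.1
  let x := T.length.unpair.2
  (t = 0 ∧ i < τ.length ∧ (¬ i + constraintLookahead x < τ.length ∨ CodeHolds τ i x)) ∨
  (t = 1 ∧ EntryTrue T x.unpair.1 i ∧ EntryTrue T x.unpair.2 i) ∨
  (t = 2 ∧ ¬ EntryTrue T x i) ∨
  (t = 3 ∧ i + 1 < τ.length ∧ EntryTrue T x (i + 1)) ∨
  (t = 4 ∧ ∃ j < τ.length, i ≤ j ∧ EntryTrue T x.unpair.2 j ∧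
    ∀ k < j, ¬ i ≤ k ∨ EntryTrue T x.unpair.1 k)

open Classical in
/-- The truth values, at the instants of `τ`, of the properties with codes less than the given
number. -/
noncomputable def truthTable {n : ℕ} (τ : List (Assignment n)) : ℕ → List (List Bool)
  | 0 => []
  | m + 1 => truthTable τ m ++
      [(List.range τ.length).map fun i => decide (StepTrue τ (truthTable τ m) i)]

@[simp]
theorem length_truthTable {n : ℕ} (τ : List (Assignment n)) :
    ∀ m, (truthTable τ m).length = m
  | 0 => rfl
  | m + 1 => by simp [truthTable, length_truthTable τ m]

theorem entryTrue_truthTable {n m x i : ℕ} {τ : List (Assignment n)} (hx : x < m)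
    (hi : i < τ.length) :
    EntryTrue (truthTable τ m) x i ↔ StepTrue τ (truthTable τ x) i := by
  induction m with
  | zero => omega
  | succ m ih =>
    rcases Nat.lt_succ_iff_lt_or_eq.1 hx with h | rfl
    · rw [← ih h, EntryTrue, EntryTrue, truthTable, List.getElem?_append_left (by simpa using h)]
    · rw [EntryTrue, truthTable, List.getElem?_append_right (by simp)]
      simp [hi]

/-- Composite properties have tags at least `1`, so their arguments have strictly smaller codes and
are found in earlier rows. Strictness fails for tag `0`, as `Nat.pair 0 0 = 0`, but atoms do not
consult the table. -/
theorem Nat.lt_pair_succ (t x : ℕ) : x < Nat.pair (t + 1) x :=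
  (Nat.right_le_pair 0 x).trans_lt (Nat.pair_lt_pair_left x (Nat.succ_pos t))

/-- Rows whose number is not the code of an IPC property have no meaning, but the recursion for an
IPC property only reads rows of its subproperties. -/
theorem entryTrue_truthTable_code {n : ℕ} (τ : List (Assignment n)) :
    ∀ {φ : LProp n}, φ.IsIPC → ∀ {m i : ℕ}, φ.code < m → i < τ.length →
      (EntryTrue (truthTable τ m) φ.code i ↔ φ.SatAt τ i)
  | .atom C, hφ, m, i, hm, hi => by
    rw [entryTrue_truthTable hm hi]
    simp [StepTrue, LProp.code, LProp.SatAt, LConstraint.WellDefined,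
      constraintLookahead_code (C := C) hφ, codeHolds_code (C := C) hφ]
  | .and φ₁ φ₂, hφ, m, i, hm, hi => by
    have h := Nat.lt_pair_succ 0 (Nat.pair φ₁.code φ₂.code)
    rw [entryTrue_truthTable hm hi, LProp.SatAt,
      ← entryTrue_truthTable_code τ hφ.1 ((Nat.left_le_pair _ _).trans_lt h) hi,
      ← entryTrue_truthTable_code τ hφ.2 ((Nat.right_le_pair _ _).trans_lt h) hi]
    simp [StepTrue, LProp.code]
  | .not φ, hφ, m, i, hm, hi => by
    rw [entryTrue_truthTable hm hi, LProp.SatAt,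
      ← entryTrue_truthTable_code τ (φ := φ) hφ (Nat.lt_pair_succ 1 φ.code) hi]
    simp [StepTrue, LProp.code]
  | .next φ, hφ, m, i, hm, hi => by
    rw [entryTrue_truthTable hm hi, LProp.SatAt]
    by_cases hi' : i + 1 < τ.length
    · rw [← entryTrue_truthTable_code τ (φ := φ) hφ (Nat.lt_pair_succ 2 φ.code) hi']
      simp [StepTrue, LProp.code]
    · simp [StepTrue, LProp.code, hi']
  | .untl φ₁ φ₂, hφ, m, i, hm, hi => by
    have h := Nat.lt_pair_succ 3 (Nat.pair φ₁.code φ₂.code)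
    have h₁ := fun j => entryTrue_truthTable_code τ hφ.1 (i := j)
      ((Nat.left_le_pair _ _).trans_lt h)
    have h₂ := fun j => entryTrue_truthTable_code τ hφ.2 (i := j)
      ((Nat.right_le_pair _ _).trans_lt h)
    rw [entryTrue_truthTable hm hi, LProp.SatAt]
    simp only [StepTrue, LProp.code, length_truthTable, Nat.unpair_pair]
    simp only [OfNat.ofNat_ne_zero, OfNat.ofNat_ne_one, Nat.reduceEqDiff, false_and, false_or,
      true_and]
    refine exists_congr fun j => ?_
    constructor
    · rintro ⟨hj, hij, hj₂, hk⟩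
      exact ⟨hij, hj, (h₂ j hj).1 hj₂, fun k hik hkj =>
        (h₁ k (hkj.trans hj)).1 ((hk k hkj).resolve_left (not_not_intro hik))⟩
    · rintro ⟨hij, hj, hj₂, hk⟩
      exact ⟨hj, hij, (h₂ j hj).2 hj₂, fun k hkj => or_iff_not_imp_left.2 fun hik =>
        (h₁ k (hkj.trans hj)).2 (hk k (not_not.1 hik) hkj)⟩

/-! ### The monitor -/

/-- The property with code `c` is satisfied by `τ`. -/
def CodeSat {n : ℕ} (c : ℕ) (τ : List (Assignment n)) : Prop :=
  EntryTrue (truthTable τ (c + 1)) c 0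

theorem codeSat_code {n : ℕ} {φ : LProp n} (hφ : φ.IsIPC) {τ : List (Assignment n)}
    (hτ : τ ≠ []) : CodeSat φ.code τ ↔ φ.Sat τ :=
  entryTrue_truthTable_code τ hφ (Nat.lt_succ_self _) (List.length_pos_iff.2 hτ)

/-- The property with code `c` is satisfied by `τ` followed by a continuation with a small code. -/
def CodeSatContinuation {n : ℕ} (c : ℕ) (τ : List (Assignment n)) : Prop :=
  ∃ t < continuationBound n c (Encodable.encode τ) + 1,
    ¬ (Encodable.decode t : Option (List (Assignment n))).getD [] = [] ∧
      CodeSat c (τ ++ (Encodable.decode t : Option (List (Assignment n))).getD [])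

/-- The bounded search is complete by `exists_small_continuation`. A number that decodes to nothing
yields the empty list, which the search rejects. -/
theorem codeSatContinuation_code {n : ℕ} {φ : LProp n} (hφ : φ.IsIPC) (τ : List (Assignment n)) :
    CodeSatContinuation φ.code τ ↔ ∃ τ' : List (Assignment n), τ' ≠ [] ∧ φ.Sat (τ ++ τ') := by
  constructor
  · rintro ⟨t, -, hne, hs⟩
    exact ⟨_, hne, (codeSat_code hφ (by simp [hne])).1 hs⟩
  · rintro ⟨τ', hne, hs⟩
    obtain ⟨ρ, hρ, hs, hb⟩ := exists_small_continuation hφ hne hs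
    refine ⟨Encodable.encode ρ, Nat.lt_succ_of_le hb, ?_⟩
    rw [Encodable.encodek, Option.getD_some]
    exact ⟨hρ, (codeSat_code hφ (by simp [hρ])).2 hs⟩

open Classical in
/-- The monitoring state of the property with code `c` after `τ`. -/
noncomputable def monitorCode {n : ℕ} (c : ℕ) (τ : List (Assignment n)) : MonState :=
  if CodeSat c τ then if CodeSatContinuation (Nat.pair 2 c) τ then .cs else .ps
  else if CodeSatContinuation c τ then .cv else .pv

theorem inMonState_monitorCode {n : ℕ} {ψ : LProp n} (hψ : ψ.IsIPC) {τ : List (Assignment n)}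
    (hτ : τ ≠ []) : InMonState ψ τ (monitorCode ψ.code τ) := by
  have h := codeSatContinuation_code hψ τ
  -- `Nat.pair 2 ψ.code` is the code of the negation of `ψ`, again an IPC property.
  have h' : CodeSatContinuation (Nat.pair 2 ψ.code) τ ↔
      ∃ τ' : List (Assignment n), τ' ≠ [] ∧ ¬ ψ.Sat (τ ++ τ') :=
    codeSatContinuation_code (φ := ψ.not) hψ τ
  rw [monitorCode, codeSat_code hψ hτ, h, h']
  split_ifs with h₁ h₂ h₂
  · exact ⟨h₁, h₂⟩
  · exact ⟨h₁, fun τ' hne => by_contra fun hs => h₂ ⟨τ', hne, hs⟩⟩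
  · exact ⟨h₁, h₂⟩
  · exact ⟨h₁, fun τ' hne hs => h₂ ⟨τ', hne, hs⟩⟩

/-! ### Primitive recursiveness of the monitor -/

section Primrec

variable {n : ℕ} {α : Type*} [Primcodable α] {τ : α → List (Assignment n)} {f g h : α → ℕ}

theorem primrec_unpair_fst (hf : Primrec f) : Primrec fun a => (f a).unpair.1 :=
  Primrec.fst.comp (Primrec.unpair.comp hf)

theorem primrec_unpair_snd (hf : Primrec f) : Primrec fun a => (f a).unpair.2 :=
  Primrec.snd.comp (Primrec.unpair.comp hf)

theorem PrimrecRel.exists_lt_left {β : Type*} [Primcodable β] {R : ℕ → β → Prop}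
    (hR : PrimrecRel R) : PrimrecRel fun m b => ∃ j < m, R j b :=
  (hR.exists_mem_list.comp₂ (Primrec.list_range.comp₂ Primrec₂.left) Primrec₂.right).of_eq
    fun m b => by simp

theorem PrimrecRel.forall_lt_left {β : Type*} [Primcodable β] {R : ℕ → β → Prop}
    (hR : PrimrecRel R) : PrimrecRel fun m b => ∀ j < m, R j b :=
  (hR.forall_mem_list.comp₂ (Primrec.list_range.comp₂ Primrec₂.left) Primrec₂.right).of_eq
    fun m b => by simp

theorem primrecPred_eq_const (hf : Primrec f) (m : ℕ) : PrimrecPred fun a => f a = m :=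
  Primrec.eq.comp hf (Primrec.const m)

theorem primrec_valueCode (hτ : Primrec τ) (hf : Primrec f) (hg : Primrec g) :
    Primrec fun a => valueCode (τ a) (f a) (g a) := by
  have hofFn : Primrec fun a : Assignment n => List.ofFn fun v => Encodable.encode (a v) :=
    Primrec.list_ofFn fun v =>
      Primrec.encode.comp (Primrec.fin_app.comp Primrec.id (Primrec.const v))
  have hlist : Primrec fun a =>
      (((τ a)[g a]?).map fun a => List.ofFn fun v => Encodable.encode (a v)).getD [] :=
    Primrec.option_getD.comp (Primrec.option_map (Primrec.list_getElem?.comp hτ hg)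
      (hofFn.comp₂ Primrec₂.right)) (Primrec.const [])
  exact Primrec.option_getD.comp (Primrec.list_getElem?.comp hlist hf) (Primrec.const 0)

theorem primrec_termCode (hτ : Primrec τ) (hf : Primrec f) (hg : Primrec g) :
    Primrec fun a => termCode (τ a) (f a) (g a) := by
  have h2 := primrec_unpair_snd hg
  exact Primrec.ite (primrecPred_eq_const (primrec_unpair_fst hg) 0)
    (primrec_valueCode hτ (primrec_unpair_fst h2) (Primrec.nat_add.comp hf (primrec_unpair_snd h2)))
    h2

theorem primrec_termLookahead (hf : Primrec f) : Primrec fun a => termLookahead (f a) :=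
  Primrec.ite (primrecPred_eq_const (primrec_unpair_fst hf) 0)
    (primrec_unpair_snd (primrec_unpair_snd hf)) (Primrec.const 0)

theorem primrec_exprLookahead (hf : Primrec f) : Primrec fun a => exprLookahead (f a) := by
  have h2 := primrec_unpair_snd hf
  exact Primrec.ite (primrecPred_eq_const (primrec_unpair_fst hf) 2)
    (Primrec.nat_max.comp (primrec_termLookahead (primrec_unpair_fst h2))
      (primrec_termLookahead (primrec_unpair_snd h2))) (primrec_termLookahead hf)

theorem primrec_codeMod (hf : Primrec f) (hg : Primrec g) :
    Primrec fun a => codeMod (f a) (g a) := by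
  have h2 := Primrec.nat_div.comp hg (Primrec.const 2)
  exact Primrec.ite (primrecPred_eq_const (Primrec.nat_mod.comp hg (Primrec.const 2)) 0)
    (Primrec.nat_mod.comp h2 hf)
    (Primrec.nat_mod.comp
      (Primrec.nat_sub.comp hf (Primrec.nat_mod.comp (Primrec.succ.comp h2) hf)) hf)

theorem primrec_exprMod (hτ : Primrec τ) (hf : Primrec f) (hg : Primrec g) (hh : Primrec h) :
    Primrec fun a => exprMod (τ a) (f a) (g a) (h a) := by
  have h2 := primrec_unpair_snd hh
  exact Primrec.ite (primrecPred_eq_const (primrec_unpair_fst hh) 2)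
    (Primrec.nat_mod.comp (Primrec.nat_add.comp
      (primrec_codeMod hg (primrec_termCode hτ hf (primrec_unpair_fst h2)))
      (primrec_codeMod hg (primrec_termCode hτ hf (primrec_unpair_snd h2)))) hg)
    (primrec_codeMod hg (primrec_termCode hτ hf hh))

theorem primrec_constraintLookahead (hf : Primrec f) :
    Primrec fun a => constraintLookahead (f a) := by
  have h2 := primrec_unpair_snd hf
  have h3 := primrec_unpair_snd h2
  exact Primrec.ite (primrecPred_eq_const (primrec_unpair_fst hf) 4)
    (Primrec.nat_max.comp (primrec_exprLookahead (primrec_unpair_fst h3))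
      (primrec_exprLookahead (primrec_unpair_snd h3)))
    (Primrec.nat_max.comp (primrec_exprLookahead (primrec_unpair_fst h2))
      (primrec_exprLookahead (primrec_unpair_snd h2)))

theorem primrecPred_codeHolds (hτ : Primrec τ) (hf : Primrec f) (hg : Primrec g) :
    PrimrecPred fun a => CodeHolds (τ a) (f a) (g a) := by
  have ht := primrecPred_eq_const (primrec_unpair_fst hg)
  have hp := primrec_unpair_fst (primrec_unpair_snd hg)
  have hq := primrec_unpair_snd (primrec_unpair_snd hg)
  have hp' := primrec_termCode hτ hf hp
  have hq' := primrec_termCode hτ hf hq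
  have hvar := primrecPred_eq_const (primrec_unpair_fst hp) 0
  have hlt := Primrec.nat_lt.comp hp' hq'
  have heq := Primrec.eq.comp hp' hq'
  exact ((ht 0).and heq).or <| ((ht 1).and heq.not).or <|
    ((ht 2).and (hvar.and ((primrecPred_eq_const
      (Primrec.nat_mod.comp hp' (Primrec.const 2)) 1).or hlt))).or <|
    ((ht 2).and (hvar.not.and ((primrecPred_eq_const
      (Primrec.nat_mod.comp hq' (Primrec.const 2)) 0).and hlt))).or <|
    (ht 4).and (Primrec.eq.comp (primrec_exprMod hτ hf hp (primrec_unpair_fst hq))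
      (primrec_exprMod hτ hf hp (primrec_unpair_snd hq)))

theorem primrecPred_entryTrue {T : α → List (List Bool)} (hT : Primrec T) (hf : Primrec f)
    (hg : Primrec g) : PrimrecPred fun a => EntryTrue (T a) (f a) (g a) :=
  Primrec.eq.comp (Primrec.list_getElem?.comp (Primrec.option_getD.comp
    (Primrec.list_getElem?.comp hT hf) (Primrec.const [])) hg) (Primrec.const (some true))

theorem primrecPred_stepTrue {T : α → List (List Bool)} (hτ : Primrec τ) (hT : Primrec T)
    (hf : Primrec f) : PrimrecPred fun a => StepTrue (τ a) (T a) (f a) := by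
  have hlen := Primrec.list_length.comp hT
  have ht := primrecPred_eq_const (primrec_unpair_fst hlen)
  have hx := primrec_unpair_snd hlen
  have hn := Primrec.list_length.comp hτ
  have hatom : PrimrecPred fun a => f a < (τ a).length ∧
      (¬ f a + constraintLookahead (T a).length.unpair.2 < (τ a).length ∨
        CodeHolds (τ a) (f a) (T a).length.unpair.2) :=
    (Primrec.nat_lt.comp hf hn).and <| (Primrec.nat_lt.comp
      (Primrec.nat_add.comp hf (primrec_constraintLookahead hx)) hn).not.or
        (primrecPred_codeHolds hτ hf hx)
  -- The bounded quantifiers act on a relation between a number and one parameter, so the table, the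
  -- row numbers and the starting instant are packed into a tuple.
  have hall : PrimrecRel fun (j : ℕ) (a : List (List Bool) × ℕ × ℕ) => ∀ k < j,
      ¬ a.2.2 ≤ k ∨ EntryTrue a.1 a.2.1 k :=
    PrimrecRel.forall_lt_left (R := fun k (a : List (List Bool) × ℕ × ℕ) => ¬ a.2.2 ≤ k ∨ EntryTrue a.1 a.2.1 k) <|
      PrimrecPred.primrecRel <| PrimrecPred.or
        (PrimrecPred.not (Primrec.nat_le.comp
          (Primrec.snd.comp (Primrec.snd.comp Primrec.snd)) Primrec.fst))
        (primrecPred_entryTrue (Primrec.fst.comp Primrec.snd)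
          (Primrec.fst.comp (Primrec.snd.comp Primrec.snd)) Primrec.fst)
  have huntl : PrimrecRel fun (m : ℕ) (a : List (List Bool) × ℕ × ℕ × ℕ) => ∃ j < m,
      a.2.2.2 ≤ j ∧ EntryTrue a.1 a.2.2.1 j ∧ ∀ k < j, ¬ a.2.2.2 ≤ k ∨ EntryTrue a.1 a.2.1 k := by
    have hT' : Primrec fun p : ℕ × List (List Bool) × ℕ × ℕ × ℕ => p.2.1 :=
      Primrec.fst.comp Primrec.snd
    have h2 : Primrec fun p : ℕ × List (List Bool) × ℕ × ℕ × ℕ => p.2.2 :=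
      Primrec.snd.comp Primrec.snd
    have h3 : Primrec fun p : ℕ × List (List Bool) × ℕ × ℕ × ℕ => p.2.2.2 :=
      Primrec.snd.comp h2
    have hp : PrimrecPred fun p : ℕ × List (List Bool) × ℕ × ℕ × ℕ =>
        p.2.2.2.2 ≤ p.1 ∧ EntryTrue p.2.1 p.2.2.2.1 p.1 ∧
          ∀ k < p.1, ¬ p.2.2.2.2 ≤ k ∨ EntryTrue p.2.1 p.2.2.1 k :=
      PrimrecPred.and (Primrec.nat_le.comp (Primrec.snd.comp h3) Primrec.fst) <|
        PrimrecPred.and (primrecPred_entryTrue hT' (Primrec.fst.comp h3) Primrec.fst)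
          (hall.comp Primrec.fst
            (Primrec.pair hT' (Primrec.pair (Primrec.fst.comp h2) (Primrec.snd.comp h3))))
    exact PrimrecRel.exists_lt_left hp.primrecRel
  exact ((ht 0).and hatom).or <|
    ((ht 1).and ((primrecPred_entryTrue hT (primrec_unpair_fst hx) hf).and
      (primrecPred_entryTrue hT (primrec_unpair_snd hx) hf))).or <|
    ((ht 2).and (primrecPred_entryTrue hT hx hf).not).or <|
    ((ht 3).and ((Primrec.nat_lt.comp (Primrec.succ.comp hf) hn).and
      (primrecPred_entryTrue hT hx (Primrec.succ.comp hf)))).or <|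
    (ht 4).and (huntl.comp hn (Primrec.pair hT
      (Primrec.pair (primrec_unpair_fst hx) (Primrec.pair (primrec_unpair_snd hx) hf))))

open Classical in
theorem primrec₂_truthTable : Primrec₂ (truthTable (n := n)) := by
  have hrow : Primrec fun p : List (Assignment n) × ℕ × List (List Bool) =>
      (List.range p.1.length).map fun i => decide (StepTrue p.1 p.2.2 i) := by
    refine Primrec.list_map
      (Primrec.list_range.comp (Primrec.list_length.comp Primrec.fst)) ?_
    exact primrecPred_iff_primrec_decide.1 (primrecPred_stepTrue
      (Primrec.fst.comp Primrec.fst) (Primrec.snd.comp (Primrec.snd.comp Primrec.fst)) Primrec.snd)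
  have := Primrec.nat_rec (f := fun _ : List (Assignment n) => ([] : List (List Bool)))
    (g := fun τ p => p.2 ++ [(List.range τ.length).map fun i => decide (StepTrue τ p.2 i)])
    (Primrec.const [])
    (Primrec.list_concat.comp₂ (Primrec.snd.comp₂ Primrec₂.right) hrow)
  refine this.of_eq fun τ m => ?_
  induction m with
  | zero => rfl
  | succ m ih => simp only [truthTable, ← ih]

theorem primrecPred_codeSat (hf : Primrec f) (hτ : Primrec τ) :
    PrimrecPred fun a => CodeSat (f a) (τ a) :=
  primrecPred_entryTrue (primrec₂_truthTable.comp hτ (Primrec.succ.comp hf)) hf (Primrec.const 0)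

theorem primrecPred_codeSatContinuation (hf : Primrec f) (hτ : Primrec τ) :
    PrimrecPred fun a => CodeSatContinuation (f a) (τ a) := by
  have hdec : Primrec fun p : ℕ × ℕ × List (Assignment n) =>
      (Encodable.decode p.1 : Option (List (Assignment n))).getD [] :=
    Primrec.option_getD.comp (Primrec.decode.comp Primrec.fst) (Primrec.const [])
  have hrel : PrimrecRel fun (m : ℕ) (p : ℕ × List (Assignment n)) => ∃ t < m,
      ¬ (Encodable.decode t : Option (List (Assignment n))).getD [] = [] ∧
        CodeSat p.1 (p.2 ++ (Encodable.decode t : Option (List (Assignment n))).getD []) :=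
    PrimrecRel.exists_lt_left (R := fun t (p : ℕ × List (Assignment n)) =>
      ¬ (Encodable.decode t : Option (List (Assignment n))).getD [] = [] ∧
        CodeSat p.1 (p.2 ++ (Encodable.decode t : Option (List (Assignment n))).getD [])) <|
      PrimrecPred.primrecRel <| PrimrecPred.and
        (PrimrecPred.not (Primrec.eq.comp hdec (Primrec.const [])))
        (primrecPred_codeSat (Primrec.fst.comp Primrec.snd)
          (Primrec.list_append.comp (Primrec.snd.comp Primrec.snd) hdec))
  exact hrel.comp (Primrec.succ.comp ((primrec₂_continuationBound n).comp hf
    (Primrec.encode.comp hτ))) (Primrec.pair hf hτ)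

theorem primrec₂_monitorCode : Primrec₂ (monitorCode (n := n)) := by
  classical
  have h := primrecPred_codeSatContinuation (n := n) (Primrec.fst (α := ℕ)) Primrec.snd
  have h' := primrecPred_codeSatContinuation (n := n)
    (Primrec₂.natPair.comp (Primrec.const 2) (Primrec.fst (α := ℕ))) Primrec.snd
  exact (Primrec.ite (primrecPred_codeSat Primrec.fst Primrec.snd)
    (Primrec.ite h' (Primrec.const .cs) (Primrec.const .ps))
    (Primrec.ite h (Primrec.const .cv) (Primrec.const .pv))).of_eq fun p => by
      simp only [monitorCode]

end Primrec

theorem mainTheorem6 (n : ℕ) : MonitoringSolvable {ψ : LProp n | ψ.IsIPC} :=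
  ⟨monitorCode, primrec₂_monitorCode.to_comp, fun _ hψ _ hτ => inMonState_monitorCode hψ hτ⟩
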